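/- Let $n\ge 1$. A dual number is $a=a_s+a_d\varepsilon$ with $a_s,a_d\in\mathbb{R}$ and $\varepsilon^2=0$, where $a_s$ is the standard part and $a_d$ the dual part. Dual numbers are totally ordered by $a>b$ iff $a_s>b_s$, or $a_s=b_s$ and $a_d>b_d$. For $b_s\ne 0$ the quotient is $\frac{a}{b}=\frac{a_s}{b_s}+\left(\frac{a_d}{b_s}-\frac{a_sb_d}{b_s^2}\right)\varepsilon$. For a dual number vector $\mathbf{x}=\mathbf{x}_s+\mathbf{x}_d\varepsilon$ put $\|\mathbf{x}\|_2=\|\mathbf{x}_s\|_2+\frac{\mathbf{x}_s^T\mathbf{x}_d}{\|\mathbf{x}_s\|_2}\varepsilon$ if $\mathbf{x}_s\neq\mathbf{0}$, and $\|\mathbf{x}\|_2=\|\mathbf{x}_d\|_2\,\varepsilon$ otherwise. Let $A=A_s+A_d\varepsilon$ (with $A_s,A_d\in\mathbb{R}^{n\times n}$) be a primitive dual number matrix, i.e. $A_s$ is entrywise nonnegative and $A_s^m$ is entrywise positive for some integer $m\ge1$. Let $\lambda=\lambda_s+\lambda_d\varepsilon$ be its Perron eigenvalue, i.e. the dual number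 $\lambda>0$ for which $A\mathbf{x}=\lambda\mathbf{x}$ for some dual number vector $\mathbf{x}$ with all entries positive and with nonzero standard part. Let $\mathbf{x}^0\in\mathbb{R}^n$ have positive entries, and run the Collatz iteration: for $k=0,1,2,\dots$, $$\mathbf{x}^{k+1}=\frac{A\mathbf{x}^k}{\|A\mathbf{x}^k\|_2},\qquad \underline{\lambda}_k=\min_i\frac{(A\mathbf{x}^k)_i}{x^k_i},\qquad \overline{\lambda}_k=\max_i\frac{(A\mathbf{x}^k)_i}{x^k_i}.$$ Then $$\lim_{k\to\infty}\left(\overline{\lambda}_k-\underline{\lambda}_k\right)=0$$ (standard and dual parts both tend to $0$), and the convergence is R-linear: there are constants $\tilde\Delta>0$ and $\eta\in(0,1)$ such that for all sufficiently large $k$ the absolute values of the standard part and of the dual part of $\overline{\lambda}_k-\underline{\lambda}_k$ are at most $\tilde\Delta\eta^k$. Moreover, let $\sigma$ be the largest modulus of the complex eigenvalues other than $1$ of $(\lambda^{-1}A)_s=\lambda_s^{-1}A_s$ (with $\sigma=0$ if there are none). Then $\sqrt{\sigma}<1$, and there is a constant $\tilde\Delta>0$ such that for all sufficiently large $k$ the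 absolute values of the standard part and of the dual part of $\overline{\lambda}_k-\underline{\lambda}_k$ are at most $\tilde\Delta(\sqrt{\sigma})^k$. -/

import Mathlib

open scoped DualNumber Matrix Topology

noncomputable section

namespace DualCollatz

/-- The total order on the real dual numbers `a = aₛ + a_d ε`: compare standard parts first and,
if they agree, dual parts. -/
instance instLinearOrder : LinearOrder ℝ[ε] :=
  LinearOrder.lift' (fun a : ℝ[ε] => toLex (a.fst, a.snd)) (fun a b h => by
    have h' : (a.fst, a.snd) = (b.fst, b.snd) := toLex.injective h
    exact TrivSqZeroExt.ext (congrArg Prod.fst h') (congrArg Prod.snd h'))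

theorem lt_iff (a b : ℝ[ε]) :
    a < b ↔ a.fst < b.fst ∨ (a.fst = b.fst ∧ a.snd < b.snd) :=
  Prod.Lex.toLex_lt_toLex (x := (a.fst, a.snd)) (y := (b.fst, b.snd))

/-- Quotient of dual numbers, for a divisor with nonzero standard part (the only case that the
Collatz iteration meets); see `fst_div'` and `snd_div'` for the explicit formula. -/
def div' (a b : ℝ[ε]) : ℝ[ε] := a * b⁻¹

theorem fst_div' (a b : ℝ[ε]) : (div' a b).fst = a.fst / b.fst := by
  simp [div', div_eq_mul_inv]

theorem snd_div' (a b : ℝ[ε]) :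
    (div' a b).snd = a.snd / b.fst - a.fst * b.snd / (b.fst * b.fst) := by
  simp [div', div_eq_mul_inv]
  ring

variable {n : ℕ}

/-- The standard part of a dual number matrix. -/
def stdPart (A : Matrix (Fin n) (Fin n) ℝ[ε]) : Matrix (Fin n) (Fin n) ℝ :=
  A.map (fun a => a.fst)

/-- A dual number matrix is primitive if its standard part is a primitive real matrix, that is,
entrywise nonnegative with some positive power entrywise positive. -/
def IsPrimitive (A : Matrix (Fin n) (Fin n) ℝ[ε]) : Prop :=
  (stdPart A).IsPrimitive

/-- `lam` is an eigenvalue of `A` with eigenvector `x`: the vector `x` is appreciable (its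
standard part is nonzero) and `A x = lam x`. -/
def IsEigenpair (A : Matrix (Fin n) (Fin n) ℝ[ε]) (lam : ℝ[ε]) (x : Fin n → ℝ[ε]) : Prop :=
  (fun i => (x i).fst) ≠ 0 ∧ A *ᵥ x = lam • x

/-- `lam` is a Perron eigenvalue of `A`: a positive dual number which is an eigenvalue of `A` with
an eigenvector all of whose entries are positive dual numbers. (For primitive `A` there is exactly
one such `lam`.) -/
def IsPerronEigenvalue (A : Matrix (Fin n) (Fin n) ℝ[ε]) (lam : ℝ[ε]) : Prop :=
  0 < lam ∧ ∃ x : Fin n → ℝ[ε], (∀ i, 0 < x i) ∧ IsEigenpair A lam x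

/-- The `2`-norm of a dual number vector, itself a dual number. -/
def norm2 (x : Fin n → ℝ[ε]) : ℝ[ε] :=
  let xs : Fin n → ℝ := fun i => (x i).fst
  let xd : Fin n → ℝ := fun i => (x i).snd
  open Classical in
  if xs ≠ 0 then
    TrivSqZeroExt.inl ‖WithLp.toLp 2 xs‖ + TrivSqZeroExt.inr ((xs ⬝ᵥ xd) / ‖WithLp.toLp 2 xs‖)
  else TrivSqZeroExt.inr ‖WithLp.toLp 2 xd‖

/-- The Collatz iteration: `x⁰` is given, and `xᵏ⁺¹ = yᵏ / ‖yᵏ‖₂` with `yᵏ = A xᵏ`. -/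
def collatzSeq (A : Matrix (Fin n) (Fin n) ℝ[ε]) (x0 : Fin n → ℝ[ε]) : ℕ → Fin n → ℝ[ε]
  | 0 => x0
  | k + 1 => fun i => div' ((A *ᵥ collatzSeq A x0 k) i) (norm2 (A *ᵥ collatzSeq A x0 k))

/-- The upper Collatz bound `maxᵢ (A x)ᵢ / xᵢ`. -/
def upperBound [NeZero n] (A : Matrix (Fin n) (Fin n) ℝ[ε]) (x : Fin n → ℝ[ε]) : ℝ[ε] :=
  Finset.univ.sup' Finset.univ_nonempty (fun i => div' ((A *ᵥ x) i) (x i))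

/-- The lower Collatz bound `minᵢ (A x)ᵢ / xᵢ`. -/
def lowerBound [NeZero n] (A : Matrix (Fin n) (Fin n) ℝ[ε]) (x : Fin n → ℝ[ε]) : ℝ[ε] :=
  Finset.univ.inf' Finset.univ_nonempty (fun i => div' ((A *ᵥ x) i) (x i))

/-- The difference of the upper and the lower Collatz bound at step `k`, for a real starting
vector. -/
def collatzGap [NeZero n] (A : Matrix (Fin n) (Fin n) ℝ[ε]) (x0 : Fin n → ℝ) (k : ℕ) : ℝ[ε] :=
  let xk := collatzSeq A (fun i => TrivSqZeroExt.inl (x0 i)) k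
  upperBound A xk - lowerBound A xk

/-- The largest modulus of the complex eigenvalues other than `1` of the standard part of
`lam⁻¹ A`. It is `0` if there is no such eigenvalue. -/
def sigma (A : Matrix (Fin n) (Fin n) ℝ[ε]) (lam : ℝ[ε]) : ℝ :=
  sSup ((fun μ : ℂ => ‖μ‖) '' (spectrum ℂ ((stdPart (lam⁻¹ • A)).map Complex.ofReal) \ {1}))

end DualCollatz

end

/-! Put `B = lam⁻¹ • A`, which fixes the Perron vector `X`. Each Collatz iterate is an invertible
multiple of `B ^ k *ᵥ x0`, and quotients ignore that multiple. They equal `lam` plus `lam` times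
(increment of `B ^ k *ᵥ x0`) / (`B ^ k *ᵥ x0`), so it suffices that increments decay and that
standard parts stay away from `0`.

On pairs (standard part, dual part), `B` acts over ℂ as the block triangular matrix with both
diagonal blocks `S = stdPart B`, so it has the eigenvalues of `S`. Positivity gives `‖μ‖ < 1` for
every eigenvalue `μ ≠ 1` (`norm_lt_one_or_eq_smul`). The eigenvalue `1` could carry a Jordan block,
but the dual fixed vector `X` excludes it (`blockEnd_sub_one_eq_zero`). Hence the start splits into
a fixed vector and one whose powers decay like `√σ ^ k` (`exists_fixed_add_decaying`). The square
root leaves room for the polynomial factors of Jordan blocks, as `σ < √σ` for `0 < σ < 1`. -/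

noncomputable section

namespace DualCollatz

/-! ### Spectral decomposition and geometric decay of powers. -/

section PowerDecay

variable {E : Type*} [NormedAddCommGroup E] [NormedSpace ℂ E]

/-- Powers of an endomorphism decay geometrically on the generalized eigenvectors of an
eigenvalue of modulus less than `ρ`. -/
theorem exists_norm_pow_apply_le {T : Module.End ℂ E} {μ : ℂ} {ρ : ℝ} (hμ : ‖μ‖ < ρ) (j : ℕ) :
    ∀ w : E, ((T - algebraMap ℂ (Module.End ℂ E) μ) ^ j) w = 0 →
      ∃ C : ℝ, ∀ k : ℕ, ‖(T ^ k) w‖ ≤ C * ρ ^ k := by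
  have hρ : 0 < ρ := (norm_nonneg μ).trans_lt hμ
  induction j with
  | zero => intro w hw; exact ⟨0, fun k => by simp_all⟩
  | succ j ih =>
    intro w hw
    obtain ⟨C', hC'⟩ := ih ((T - algebraMap ℂ (Module.End ℂ E) μ) w) (by
      rw [pow_succ] at hw; exact hw)
    -- The second entry makes `‖μ‖ * C + C' ≤ C * ρ`, which closes the induction on `k`; the first
    -- covers `k = 0`.
    refine ⟨max ‖w‖ (C' / (ρ - ‖μ‖)), fun k => ?_⟩
    set C := max ‖w‖ (C' / (ρ - ‖μ‖)) with hC
    induction k with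
    | zero => simp [hC]
    | succ k ihk =>
      have h1 : (T ^ (k + 1)) w =
          μ • (T ^ k) w + (T ^ k) ((T - algebraMap ℂ (Module.End ℂ E) μ) w) := by
        rw [pow_succ]
        simp [Module.algebraMap_end_apply]
      have h2 : C' ≤ C * (ρ - ‖μ‖) := by
        rw [← div_le_iff₀ (by linarith)]; exact le_max_right _ _
      calc ‖(T ^ (k + 1)) w‖ ≤ ‖μ‖ * (C * ρ ^ k) + C' * ρ ^ k := by
            rw [h1]
            refine (norm_add_le _ _).trans (add_le_add ?_ (hC' k))
            rw [norm_smul]; gcongr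
        _ ≤ ‖μ‖ * (C * ρ ^ k) + C * (ρ - ‖μ‖) * ρ ^ k := by gcongr
        _ = C * ρ ^ (k + 1) := by ring

/-- If `1` is a semisimple eigenvalue and all the other nonzero eigenvalues have modulus less than
`ρ`, then every vector is the sum of a fixed vector and of a vector on which the powers decay
like `ρ ^ k`. -/
theorem exists_fixed_add_decaying [FiniteDimensional ℂ E] (T : Module.End ℂ E) {ρ : ℝ}
    (hspec : ∀ μ, T.HasEigenvalue μ → μ = 1 ∨ μ = 0 ∨ ‖μ‖ < ρ)
    (hss : ∀ z, (T - 1) ((T - 1) z) = 0 → (T - 1) z = 0) (z : E) :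
    ∃ u v, z = u + v ∧ T u = u ∧
      (fun k : ℕ => (T ^ k) v) =O[Filter.atTop] (fun k : ℕ => ρ ^ k) := by
  have hpow : ∀ j : ℕ, ∀ z, ((T - 1) ^ j) z = 0 → (T - 1) z = 0 := by
    intro j
    induction j with
    | zero => intro z hz; simp_all
    | succ j ih =>
      intro z hz
      rw [pow_succ] at hz
      exact hss _ (ih _ hz)
  have hz : z ∈ ⨆ μ : ℂ, T.maxGenEigenspace μ := by
    rw [Module.End.iSup_maxGenEigenspace_eq_top]; trivial
  induction hz using Submodule.iSup_induction' with
  | zero => exact ⟨0, 0, by simp, by simp, by simpa using Asymptotics.isBigO_zero _ _⟩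
  | add x y _ _ hx hy =>
    obtain ⟨u, v, rfl, hu, hv⟩ := hx
    obtain ⟨u', v', rfl, hu', hv'⟩ := hy
    refine ⟨u + u', v + v', by abel, by simp [hu, hu'], ?_⟩
    simpa using hv.add hv'
  | mem μ x hx =>
    by_cases hx0 : x = 0
    · subst hx0; exact ⟨0, 0, by simp, by simp, by simpa using Asymptotics.isBigO_zero _ _⟩
    obtain ⟨j, hj⟩ := (Module.End.mem_maxGenEigenspace T μ x).1 hx
    have hev : T.HasEigenvalue μ := by
      have hne : T.HasUnifEigenvalue μ ⊤ := fun h => hx0 (by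
        rw [Module.End.maxGenEigenspace, h] at hx; simpa using hx)
      exact hne.lt (by norm_num)
    rcases hspec μ hev with rfl | rfl | hlt
    · refine ⟨x, 0, by simp, ?_, by simpa using Asymptotics.isBigO_zero _ _⟩
      have := hpow j x (by simpa using hj)
      exact sub_eq_zero.1 (by simpa using this)
    -- `ρ` may be `0` here, so no geometric bound is used: on this generalized eigenspace the powers
    -- vanish from `j` on.
    · refine ⟨0, x, by simp, by simp, ?_⟩
      refine (Asymptotics.isBigO_zero _ _).congr' ?_ Filter.EventuallyEq.rfl
      filter_upwards [Filter.eventually_ge_atTop j] with k hk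
      obtain ⟨i, rfl⟩ := Nat.exists_eq_add_of_le' hk
      have : (T ^ j) x = 0 := by simpa using hj
      rw [pow_add, Module.End.mul_apply, this, map_zero]
    · refine ⟨0, x, by simp, by simp, ?_⟩
      obtain ⟨C, hC⟩ := exists_norm_pow_apply_le hlt j x hj
      have hρ : 0 < ρ := (norm_nonneg μ).trans_lt hlt
      refine Asymptotics.IsBigO.of_bound C (Filter.Eventually.of_forall fun k => ?_)
      rw [Real.norm_of_nonneg (by positivity)]
      exact hC k

end PowerDecay

/-! ### Perron–Frobenius facts for primitive real matrices. -/

section Positive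

variable {ι : Type*} [Fintype ι]

/-- Weighted oscillation strictly decreases under a positive matrix with a positive fixed vector. -/
theorem norm_sub_lt_of_pos {P : Matrix ι ι ℝ} {x : ι → ℝ} (hP : ∀ i j, 0 < P i j)
    (hx : ∀ i, 0 < x i) (hfix : P *ᵥ x = x) {u : ι → ℂ} {d : ℝ} (hd : 0 < d)
    (hu : ∀ i j, ‖u i - u j‖ ≤ d) (i j : ι) :
    ‖(P.map Complex.ofReal *ᵥ fun k => u k * x k) i / x i -
      (P.map Complex.ofReal *ᵥ fun k => u k * x k) j / x j‖ < d := by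
  -- Conjugation by the diagonal of `x` makes `P` row-stochastic, so the two quotients become
  -- averages of `u`.
  set Q : ι → ι → ℝ := fun i k => P i k * x k / x i with hQ
  have hQpos : ∀ i k, 0 < Q i k := fun i k => div_pos (mul_pos (hP i k) (hx k)) (hx i)
  have hQsum : ∀ i, ∑ k, Q i k = 1 := fun i => by
    have := congrFun hfix i
    simp only [Matrix.mulVec, dotProduct] at this
    rw [hQ, ← Finset.sum_div, this, div_self (hx i).ne']
  have hrow : ∀ i, (P.map Complex.ofReal *ᵥ fun k => u k * x k) i / x i = ∑ k, (Q i k : ℂ) * u k := by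
    intro i
    simp only [Matrix.mulVec, dotProduct, Matrix.map_apply, Finset.sum_div, hQ]
    refine Finset.sum_congr rfl fun k _ => ?_
    push_cast; ring
  have hQsum' : ∀ i, ∑ k, (Q i k : ℂ) = 1 := fun i => by exact_mod_cast hQsum i
  have key : ∑ k, (Q i k : ℂ) * u k - ∑ k, (Q j k : ℂ) * u k =
      ∑ k, ∑ l, ((Q i k * Q j l : ℝ) : ℂ) * (u k - u l) := by
    have h1 : ∑ k, ∑ l, ((Q i k * Q j l : ℝ) : ℂ) * u k = ∑ k, (Q i k : ℂ) * u k := by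
      refine Finset.sum_congr rfl fun k _ => ?_
      push_cast
      rw [← Finset.sum_mul, ← Finset.mul_sum, hQsum', mul_one]
    have h2 : ∑ k, ∑ l, ((Q i k * Q j l : ℝ) : ℂ) * u l = ∑ k, (Q j k : ℂ) * u k := by
      rw [Finset.sum_comm]
      refine Finset.sum_congr rfl fun k _ => ?_
      push_cast
      rw [← Finset.sum_mul, ← Finset.sum_mul, hQsum', one_mul]
    simp only [mul_sub, Finset.sum_sub_distrib, h1, h2]
  rw [hrow, hrow, key]
  have hle : ∀ k l, ‖((Q i k * Q j l : ℝ) : ℂ) * (u k - u l)‖ ≤ Q i k * Q j l * d := fun k l => by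
    have := mul_pos (hQpos i k) (hQpos j l)
    rw [norm_mul, Complex.norm_real, Real.norm_of_nonneg this.le]
    gcongr; exact hu k l
  calc ‖∑ k, ∑ l, ((Q i k * Q j l : ℝ) : ℂ) * (u k - u l)‖
      ≤ ∑ k, ∑ l, ‖((Q i k * Q j l : ℝ) : ℂ) * (u k - u l)‖ :=
        (norm_sum_le _ _).trans (Finset.sum_le_sum fun k _ => norm_sum_le _ _)
    _ < ∑ k, ∑ l, Q i k * Q j l * d := by
        -- Strictness comes from the term `k = l = i`, where `u k - u l` vanishes but the weight is
        -- positive.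
        refine Finset.sum_lt_sum (fun k _ => Finset.sum_le_sum fun l _ => hle k l)
          ⟨i, Finset.mem_univ _, Finset.sum_lt_sum (fun l _ => hle i l) ⟨i, Finset.mem_univ _, ?_⟩⟩
        have := mul_pos (hQpos i i) (hQpos j i)
        simpa using mul_pos this hd
    _ = d := by
        simp only [← Finset.sum_mul, ← Finset.mul_sum, hQsum, one_mul, mul_one]

theorem pow_mulVec_of_mulVec_eq [DecidableEq ι] {R : Type*} [CommSemiring R] {M : Matrix ι ι R} {y : ι → R} {μ : R}
    (h : M *ᵥ y = μ • y) (k : ℕ) : (M ^ k) *ᵥ y = μ ^ k • y := by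
  induction k with
  | zero => simp
  | succ k ih => rw [pow_succ, ← Matrix.mulVec_mulVec, h, Matrix.mulVec_smul, ih, smul_smul, pow_succ']

/-- An eigenvalue of a primitive matrix with a positive fixed vector `x` either has modulus less
than `1` or is `1`, with all its eigenvectors proportional to `x`. -/
theorem norm_lt_one_or_eq_smul [DecidableEq ι] {S : Matrix ι ι ℝ} (hS : S.IsPrimitive) {x : ι → ℝ}
    (hx : ∀ i, 0 < x i) (hfix : S *ᵥ x = x) {μ : ℂ} {y : ι → ℂ} (hy0 : y ≠ 0)
    (hy : S.map Complex.ofReal *ᵥ y = μ • y) :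
    ‖μ‖ < 1 ∨ μ = 1 ∧ ∃ c : ℂ, y = fun i => c * x i := by
  obtain ⟨m, hm, hpos⟩ := hS.exists_pos_pow
  have hne : Nonempty ι := by
    by_contra h
    rw [not_nonempty_iff] at h
    exact hy0 (Subsingleton.elim _ _)
  have hxC : ∀ i, (x i : ℂ) ≠ 0 := fun i => by exact_mod_cast (hx i).ne'
  set u : ι → ℂ := fun i => y i / x i with hu
  have hyu : y = fun k => u k * x k := by
    ext k; simp only [hu]; rw [div_mul_cancel₀ _ (hxC k)]
  -- Zero oscillation makes `y` proportional to `x`; otherwise `S ^ m` shrinks it strictly while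
  -- multiplying it by `‖μ‖ ^ m`.
  obtain ⟨⟨i, j⟩, hij⟩ := Finite.exists_max (fun p : ι × ι => ‖u p.1 - u p.2‖)
  have hmax : ∀ k l, ‖u k - u l‖ ≤ ‖u i - u j‖ := fun k l => hij (k, l)
  rcases (norm_nonneg (u i - u j)).eq_or_lt with h0 | hd
  · right
    have hconst : ∀ k, u k = u i := fun k => by
      have := hmax k i
      rw [← h0] at this
      exact sub_eq_zero.1 (norm_le_zero_iff.1 this)
    have hyc : y = fun k => u i * x k := by
      rw [hyu]; ext k; simp only [hconst k]
    refine ⟨?_, u i, hyc⟩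
    have hSy : S.map Complex.ofReal *ᵥ y = y := by
      ext k
      have h1 := congrArg (Complex.ofReal) (congrFun hfix k)
      simp only [Matrix.mulVec, dotProduct, Complex.ofReal_sum, Complex.ofReal_mul] at h1
      rw [hyc]
      simp only [Matrix.mulVec, dotProduct, Matrix.map_apply]
      rw [← h1, Finset.mul_sum]
      exact Finset.sum_congr rfl fun l _ => by ring
    obtain ⟨k, hk⟩ := Function.ne_iff.1 hy0
    have h2 := congrFun (hSy.symm.trans hy) k
    simp only [Pi.smul_apply, smul_eq_mul] at h2
    exact (mul_right_cancel₀ hk (by rw [one_mul]; exact h2)).symm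
  · left
    have hPx : (S ^ m) *ᵥ x = x := by
      simpa using pow_mulVec_of_mulVec_eq (M := S) (μ := 1) (by simpa using hfix) m
    have hPy : (S ^ m).map Complex.ofReal *ᵥ y = μ ^ m • y := by
      have := pow_mulVec_of_mulVec_eq hy m
      have h3 : (S ^ m).map Complex.ofReal = (S.map Complex.ofReal) ^ m :=
        map_pow (Complex.ofRealHom.mapMatrix) S m
      rwa [h3]
    have := norm_sub_lt_of_pos hpos hx hPx hd hmax i j
    rw [← hyu, hPy] at this
    have h4 : (μ ^ m • y) i / x i - (μ ^ m • y) j / x j = μ ^ m * (u i - u j) := by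
      simp only [Pi.smul_apply, smul_eq_mul, hu]; ring
    rw [h4, norm_mul, norm_pow] at this
    by_contra h
    have h5 : 1 ≤ ‖μ‖ ^ m := one_le_pow₀ (not_lt.1 h)
    nlinarith

/-- The eigenvalue `1` of a nonnegative matrix with a positive fixed vector `x` admits no Jordan
chain ending at `x`. -/
theorem eq_zero_of_mulVec_eq_add [Nonempty ι] {S : Matrix ι ι ℝ} (hS : ∀ i j, 0 ≤ S i j)
    {x : ι → ℝ} (hx : ∀ i, 0 < x i) (hfix : S *ᵥ x = x) {c : ℂ} {y : ι → ℂ}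
    (hy : S.map Complex.ofReal *ᵥ y = y + fun i => c * x i) : c = 0 := by
  -- Multiplying by the conjugate of `c` turns the hypothesis into the real identity `S f = f + |c|²
  -- x`. Where `f / x` is maximal, `S f ≤ f`, so `c = 0`.
  set f : ι → ℝ := fun i => ((starRingEnd ℂ) c * y i).re with hf
  have hSf : ∀ i, ∑ k, S i k * f k = f i + Complex.normSq c * x i := fun i => by
    have h := congrArg (fun w => ((starRingEnd ℂ) c * w).re) (congrFun hy i)
    simp only [Matrix.mulVec, dotProduct, Matrix.map_apply, Pi.add_apply, Finset.mul_sum,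
      Complex.re_sum, mul_add, Complex.add_re] at h
    convert h using 2
    · rw [mul_left_comm, Complex.re_ofReal_mul]
    · rw [← mul_assoc, mul_comm ((starRingEnd ℂ) c), Complex.mul_conj, ← Complex.ofReal_mul,
        Complex.ofReal_re]
  obtain ⟨i, hi⟩ := Finite.exists_max (fun k => f k / x k)
  have hle : ∑ k, S i k * f k ≤ f i := by
    calc ∑ k, S i k * f k ≤ ∑ k, S i k * (f i / x i * x k) := by
          refine Finset.sum_le_sum fun k _ => mul_le_mul_of_nonneg_left ?_ (hS i k)
          rw [← div_le_iff₀ (hx k)]; exact hi k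
      _ = f i / x i * (S *ᵥ x) i := by
          simp only [Matrix.mulVec, dotProduct, Finset.mul_sum]
          exact Finset.sum_congr rfl fun k _ => by ring
      _ = f i := by rw [hfix, div_mul_cancel₀ _ (hx i).ne']
  rw [hSf] at hle
  have h1 : Complex.normSq c * x i ≤ 0 := by linarith
  have h2 : Complex.normSq c ≤ 0 := by
    by_contra h
    exact absurd h1 (not_le.2 (mul_pos (not_le.1 h) (hx i)))
  exact Complex.normSq_eq_zero.1 (le_antisymm h2 (Complex.normSq_nonneg c))

end Positive

variable {n : ℕ}

/-! ### The block triangular action on standard and dual parts. -/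

section Block

/-- The dual part of a dual number matrix. -/
def dualPart (B : Matrix (Fin n) (Fin n) ℝ[ε]) : Matrix (Fin n) (Fin n) ℝ :=
  B.map (fun a => a.snd)

theorem fst_mulVec (B : Matrix (Fin n) (Fin n) ℝ[ε]) (z : Fin n → ℝ[ε]) (i : Fin n) :
    ((B *ᵥ z) i).fst = (stdPart B *ᵥ fun j => (z j).fst) i := by
  simp [Matrix.mulVec, dotProduct, stdPart, TrivSqZeroExt.fst_sum]

theorem snd_mulVec (B : Matrix (Fin n) (Fin n) ℝ[ε]) (z : Fin n → ℝ[ε]) (i : Fin n) :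
    ((B *ᵥ z) i).snd =
      (stdPart B *ᵥ fun j => (z j).snd) i + (dualPart B *ᵥ fun j => (z j).fst) i := by
  simp [Matrix.mulVec, dotProduct, stdPart, dualPart, TrivSqZeroExt.snd_sum,
    Finset.sum_add_distrib, mul_comm]

/-- Complexification of a dual number vector, as the pair of its standard and dual parts. -/
def complexify (z : Fin n → ℝ[ε]) : (Fin n → ℂ) × (Fin n → ℂ) :=
  (fun i => ((z i).fst : ℂ), fun i => ((z i).snd : ℂ))

theorem norm_fst_le_complexify (z : Fin n → ℝ[ε]) (i : Fin n) : |(z i).fst| ≤ ‖complexify z‖ := by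
  have h := (norm_le_pi_norm (complexify z).1 i).trans (norm_fst_le (complexify z))
  simpa [complexify] using h

theorem norm_snd_le_complexify (z : Fin n → ℝ[ε]) (i : Fin n) : |(z i).snd| ≤ ‖complexify z‖ := by
  have h := (norm_le_pi_norm (complexify z).2 i).trans (norm_snd_le (complexify z))
  simpa [complexify] using h

theorem complexify_sub (z w : Fin n → ℝ[ε]) :
    complexify (z - w) = complexify z - complexify w := by
  ext i <;> simp [complexify]

/-- The action of a dual number matrix on pairs of complex vectors. -/
def blockEnd (B : Matrix (Fin n) (Fin n) ℝ[ε]) : Module.End ℂ ((Fin n → ℂ) × (Fin n → ℂ)) :=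
  (((stdPart B).map Complex.ofReal).mulVecLin ∘ₗ LinearMap.fst ℂ _ _).prod
    (((stdPart B).map Complex.ofReal).mulVecLin ∘ₗ LinearMap.snd ℂ _ _ +
      ((dualPart B).map Complex.ofReal).mulVecLin ∘ₗ LinearMap.fst ℂ _ _)

theorem blockEnd_apply (B : Matrix (Fin n) (Fin n) ℝ[ε]) (z : (Fin n → ℂ) × (Fin n → ℂ)) :
    blockEnd B z = ((stdPart B).map Complex.ofReal *ᵥ z.1,
      (stdPart B).map Complex.ofReal *ᵥ z.2 + (dualPart B).map Complex.ofReal *ᵥ z.1) := rfl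

theorem ofReal_mulVec (M : Matrix (Fin n) (Fin n) ℝ) (x : Fin n → ℝ) :
    (M.map Complex.ofReal *ᵥ fun i => (x i : ℂ)) = fun i => ((M *ᵥ x) i : ℂ) := by
  ext i
  simp [Matrix.mulVec, dotProduct]

theorem blockEnd_complexify (B : Matrix (Fin n) (Fin n) ℝ[ε]) (z : Fin n → ℝ[ε]) :
    blockEnd B (complexify z) = complexify (B *ᵥ z) := by
  simp only [blockEnd_apply, complexify, ofReal_mulVec, fst_mulVec, snd_mulVec]
  ext i <;> simp

theorem blockEnd_pow_complexify (B : Matrix (Fin n) (Fin n) ℝ[ε]) (z : Fin n → ℝ[ε]) (k : ℕ) :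
    (blockEnd B ^ k) (complexify z) = complexify ((B ^ k) *ᵥ z) := by
  induction k with
  | zero => simp
  | succ k ih =>
    rw [pow_succ', Module.End.mul_apply, ih, blockEnd_complexify, Matrix.mulVec_mulVec, ← pow_succ']

/-- The first component of an eigenvector serves if nonzero; otherwise the coupling term drops out
and the second does. -/
theorem exists_eigenvector_of_blockEnd {B : Matrix (Fin n) (Fin n) ℝ[ε]} {μ : ℂ}
    (h : (blockEnd B).HasEigenvalue μ) :
    ∃ y : Fin n → ℂ, y ≠ 0 ∧ (stdPart B).map Complex.ofReal *ᵥ y = μ • y := by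
  obtain ⟨⟨a, b⟩, hv⟩ := h.exists_hasEigenvector
  have h1 := hv.apply_eq_smul
  rw [blockEnd_apply, Prod.smul_mk, Prod.mk.injEq] at h1
  by_cases ha : a = 0
  · subst ha
    refine ⟨b, fun hb => hv.2 (by rw [hb]; rfl), by simpa using h1.2⟩
  · exact ⟨a, ha, h1.1⟩

theorem exists_eq_smul_of_fixed {S : Matrix (Fin n) (Fin n) ℝ} (hS : S.IsPrimitive)
    {x : Fin n → ℝ} (hx : ∀ i, 0 < x i) (hfix : S *ᵥ x = x) {y : Fin n → ℂ}
    (hy : S.map Complex.ofReal *ᵥ y = y) : ∃ c : ℂ, y = fun i => c * x i := by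
  by_cases hy0 : y = 0
  · exact ⟨0, by ext; simp [hy0]⟩
  · rcases norm_lt_one_or_eq_smul hS hx hfix (μ := 1) hy0 (by simpa using hy) with h | h
    · simp at h
    · exact h.2

/-- If a primitive dual number matrix fixes a dual number vector with positive standard part, then
`1` is a semisimple eigenvalue of its block action. -/
theorem blockEnd_sub_one_eq_zero [NeZero n] {B : Matrix (Fin n) (Fin n) ℝ[ε]} (hB : IsPrimitive B)
    {X : Fin n → ℝ[ε]} (hX : ∀ i, 0 < (X i).fst) (hfix : B *ᵥ X = X)
    (z : (Fin n → ℂ) × (Fin n → ℂ)) (hz : (blockEnd B - 1) ((blockEnd B - 1) z) = 0) :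
    (blockEnd B - 1) z = 0 := by
  obtain ⟨a, b⟩ := z
  set S := (stdPart B).map Complex.ofReal with hS
  set D := (dualPart B).map Complex.ofReal with hD
  have hfs : (stdPart B *ᵥ fun j => (X j).fst) = fun j => (X j).fst := by
    ext i; rw [← fst_mulVec, hfix]
  have hXC : blockEnd B (complexify X) = complexify X := by rw [blockEnd_complexify, hfix]
  have happ : ∀ a b : Fin n → ℂ, (blockEnd B - 1) (a, b) = (S *ᵥ a - a, S *ᵥ b + D *ᵥ a - b) :=
    fun a b => rfl
  rw [happ, happ, Prod.mk_eq_zero] at hz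
  rw [happ]
  dsimp only at hz
  obtain ⟨c, hc⟩ := exists_eq_smul_of_fixed hB hX hfs (sub_eq_zero.1 hz.1)
  have hc0 : c = 0 := eq_zero_of_mulVec_eq_add hB.nonneg hX hfs (y := a)
    (by rw [← hc, ← hS]; abel)
  have ha : S *ᵥ a - a = 0 := by rw [hc, hc0]; ext; simp
  obtain ⟨e, he⟩ := exists_eq_smul_of_fixed hB hX hfs (sub_eq_zero.1 ha)
  have h2 := hz.2
  rw [ha, Matrix.mulVec_zero, add_zero] at h2
  obtain ⟨c', hc'⟩ := exists_eq_smul_of_fixed hB hX hfs (sub_eq_zero.1 h2)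
  have he' : a = e • (complexify X).1 := he
  have h3 : S *ᵥ (complexify X).2 + D *ᵥ (complexify X).1 = (complexify X).2 :=
    congrArg Prod.snd hXC
  -- Since `a` is `e` times the standard part of `X`, subtracting `e` times its dual part absorbs `D
  -- *ᵥ a`, leaving a Jordan chain for `S` alone.
  have hc0' : c' = 0 := eq_zero_of_mulVec_eq_add hB.nonneg hX hfs (y := b - e • (complexify X).2)
    (by
      rw [← hc', he', Matrix.mulVec_smul, Matrix.mulVec_sub, Matrix.mulVec_smul]
      rw [← hS, eq_sub_of_add_eq h3, smul_sub]
      abel)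
  have hb : S *ᵥ b + D *ᵥ a - b = 0 := by rw [hc', hc0']; ext; simp
  rw [ha, hb]; rfl

end Block

/-! ### The subdominant modulus. -/

section Sigma

/-- The spectrum is finite, so the supremum is attained and strict inequality survives; over the
empty set it is `0`. -/
theorem sigma_bounds {B : Matrix (Fin n) (Fin n) ℝ} (hB : B.IsPrimitive) {x : Fin n → ℝ}
    (hx : ∀ i, 0 < x i) (hfix : B *ᵥ x = x) :
    let σ := sSup ((fun μ : ℂ => ‖μ‖) '' (spectrum ℂ (B.map Complex.ofReal) \ {1}))
    σ < 1 ∧ ∀ (μ : ℂ) (y : Fin n → ℂ), y ≠ 0 → B.map Complex.ofReal *ᵥ y = μ • y →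
      μ = 1 ∨ ‖μ‖ ≤ σ := by
  intro σ
  set s := (fun μ : ℂ => ‖μ‖) '' (spectrum ℂ (B.map Complex.ofReal) \ {1}) with hs
  have hspec : ∀ μ : ℂ, μ ∈ spectrum ℂ (B.map Complex.ofReal) ↔
      ∃ y : Fin n → ℂ, y ≠ 0 ∧ B.map Complex.ofReal *ᵥ y = μ • y := fun μ => by
    rw [← Matrix.spectrum_toLin', ← Module.End.hasEigenvalue_iff_mem_spectrum]
    constructor
    · intro h
      obtain ⟨y, hy⟩ := h.exists_hasEigenvector
      exact ⟨y, hy.2, by simpa using hy.apply_eq_smul⟩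
    · rintro ⟨y, hy0, hy⟩
      exact Module.End.hasEigenvalue_of_hasEigenvector
        (x := y) ⟨Module.End.mem_eigenspace_iff.2 (by simpa using hy), hy0⟩
  have hfin : s.Finite := by
    rw [hs, ← Matrix.spectrum_toLin']
    exact ((Module.End.finite_spectrum _).subset Set.sdiff_subset).image _
  refine ⟨?_, ?_⟩
  · rcases s.eq_empty_or_nonempty with h | h
    · change sSup s < 1
      simp [h]
    · obtain ⟨μ, ⟨hμ, hμ1⟩, hμs⟩ := h.csSup_mem hfin
      obtain ⟨y, hy0, hy⟩ := (hspec μ).1 hμ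
      rcases norm_lt_one_or_eq_smul hB hx hfix hy0 hy with h | h
      · change sSup s < 1
        rw [← hμs]; exact h
      · exact absurd h.1 hμ1
  · intro μ y hy0 hy
    by_cases hμ : μ = 1
    · exact Or.inl hμ
    · exact Or.inr (le_csSup hfin.bddAbove ⟨μ, ⟨(hspec μ).2 ⟨y, hy0, hy⟩, hμ⟩, rfl⟩)

end Sigma

/-! ### Standard parts of the Perron pair. -/

section Perron

theorem stdPart_smul (c : ℝ[ε]) (A : Matrix (Fin n) (Fin n) ℝ[ε]) :
    stdPart (c • A) = c.fst • stdPart A := by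
  ext i j; simp [stdPart]

theorem fst_nonneg_of_pos {a : ℝ[ε]} (h : 0 < a) : 0 ≤ a.fst := by
  rcases (lt_iff 0 a).1 h with h | h
  · exact le_of_lt (by simpa using h)
  · exact le_of_eq (by simpa using h.1)

/-- Positive dual numbers may have zero standard part. A positive power of `stdPart A` sends the
nonnegative nonzero standard part of `X` to a positive vector, which is also `lam.fst ^ m` times it.
-/
theorem IsPrimitive.perron_fst_pos {A : Matrix (Fin n) (Fin n) ℝ[ε]} (hA : IsPrimitive A)
    {lam : ℝ[ε]} (hlam : 0 < lam) {X : Fin n → ℝ[ε]} (hX : ∀ i, 0 < X i)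
    (hAX : IsEigenpair A lam X) : 0 < lam.fst ∧ ∀ i, 0 < (X i).fst := by
  obtain ⟨m, hm, hpos⟩ := hA.exists_pos_pow
  have hl := fst_nonneg_of_pos hlam
  have hXn : ∀ i, 0 ≤ (X i).fst := fun i => fst_nonneg_of_pos (hX i)
  have h1 : stdPart A *ᵥ (fun i => (X i).fst) = lam.fst • fun i => (X i).fst := by
    ext i; rw [← fst_mulVec, hAX.2]; simp
  have h2 := pow_mulVec_of_mulVec_eq h1 m
  obtain ⟨j, hj⟩ := Function.ne_iff.1 hAX.1
  have h3 : ∀ i, 0 < lam.fst ^ m * (X i).fst := fun i => by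
    have := congrFun h2 i
    simp only [Pi.smul_apply, smul_eq_mul] at this
    rw [← this]
    exact Finset.sum_pos' (fun k _ => mul_nonneg (hpos i k).le (hXn k))
      ⟨j, Finset.mem_univ _, mul_pos (hpos i j) ((hXn j).lt_of_ne' hj)⟩
  refine ⟨hl.lt_of_ne' fun h => ?_, fun i => (hXn i).lt_of_ne' fun h => ?_⟩
  · have := h3 j; rw [h, zero_pow (by omega), zero_mul] at this; exact lt_irrefl _ this
  · have := h3 i; rw [h, mul_zero] at this; exact lt_irrefl _ this

theorem IsPrimitive.smul {A : Matrix (Fin n) (Fin n) ℝ[ε]} (hA : IsPrimitive A) {c : ℝ[ε]}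
    (hc : 0 < c.fst) : IsPrimitive (c • A) := by
  obtain ⟨m, hm, hpos⟩ := hA.exists_pos_pow
  refine ⟨fun i j => ?_, m, hm, fun i j => ?_⟩
  · rw [stdPart_smul]; exact mul_nonneg hc.le (hA.nonneg i j)
  · rw [stdPart_smul, smul_pow]; exact mul_pos (pow_pos hc m) (hpos i j)

end Perron

/-! ### Collatz quotients in terms of rescaled iterates. -/

section Collatz

theorem div'_mul_mul {c : ℝ[ε]} (hc : c.fst ≠ 0) (a b : ℝ[ε]) : div' (c * a) (c * b) = div' a b := by
  rw [div', TrivSqZeroExt.mul_inv_rev, div']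
  calc c * a * (b⁻¹ * c⁻¹) = a * b⁻¹ * (c * c⁻¹) := by ring
    _ = a * b⁻¹ := by rw [TrivSqZeroExt.mul_inv_cancel hc, mul_one]

theorem fst_norm2_ne_zero {x : Fin n → ℝ[ε]} (hx : (fun i => (x i).fst) ≠ 0) :
    (norm2 x).fst ≠ 0 := by
  rw [norm2, if_pos hx]
  simpa using hx

theorem mulVec_lower_bound {S : Matrix (Fin n) (Fin n) ℝ} (hS : ∀ i j, 0 ≤ S i j) {x y : Fin n → ℝ}
    (hfix : S *ᵥ x = x) {c : ℝ} (h : ∀ i, c * x i ≤ y i) (i : Fin n) : c * x i ≤ (S *ᵥ y) i := by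
  calc c * x i = c * (S *ᵥ x) i := by rw [hfix]
    _ = ∑ j, S i j * (c * x j) := by
      simp only [Matrix.mulVec, dotProduct, Finset.mul_sum]
      exact Finset.sum_congr rfl fun j _ => by ring
    _ ≤ _ := Finset.sum_le_sum fun j _ => mul_le_mul_of_nonneg_left (h j) (hS i j)

/-- A normalized Collatz iterate is an appreciable multiple of the corresponding power of the
rescaled matrix applied to the starting vector. -/
theorem exists_collatzSeq_eq_smul [NeZero n] {A B : Matrix (Fin n) (Fin n) ℝ[ε]} {lam : ℝ[ε]}
    (hlam : lam.fst ≠ 0) (hAB : A = lam • B) (x0 : Fin n → ℝ[ε])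
    (hpos : ∀ k i, 0 < (((B ^ k) *ᵥ x0) i).fst) (k : ℕ) :
    ∃ c : ℝ[ε], c.fst ≠ 0 ∧ collatzSeq A x0 k = c • ((B ^ k) *ᵥ x0) := by
  induction k with
  | zero => exact ⟨1, by simp, by simp [collatzSeq]⟩
  | succ k ih =>
    obtain ⟨c, hc, hk⟩ := ih
    have h1 : A *ᵥ collatzSeq A x0 k = (c * lam) • ((B ^ (k + 1)) *ᵥ x0) := by
      rw [hk, Matrix.mulVec_smul, hAB, Matrix.smul_mulVec, Matrix.mulVec_mulVec, ← pow_succ',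
        smul_smul]
    have h2 : (norm2 (A *ᵥ collatzSeq A x0 k)).fst ≠ 0 := by
      refine fst_norm2_ne_zero fun h => ?_
      have := congrFun h 0
      rw [h1] at this
      simp only [Pi.smul_apply, smul_eq_mul, TrivSqZeroExt.fst_mul, Pi.zero_apply] at this
      exact mul_ne_zero (mul_ne_zero hc hlam) (hpos (k + 1) 0).ne' this
    refine ⟨c * lam * (norm2 (A *ᵥ collatzSeq A x0 k))⁻¹, ?_, ?_⟩
    · simp only [TrivSqZeroExt.fst_mul, TrivSqZeroExt.fst_inv]
      exact mul_ne_zero (mul_ne_zero hc hlam) (inv_ne_zero h2)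
    · ext1 i
      change (A *ᵥ collatzSeq A x0 k) i * (norm2 (A *ᵥ collatzSeq A x0 k))⁻¹ = _
      rw [h1]
      simp only [Pi.smul_apply, smul_eq_mul]
      ring


/-- In terms of the rescaled iterates, the Collatz quotients are `lam` up to a multiple of the
quotients of the increments. -/
theorem div'_mulVec_collatzSeq [NeZero n] {A B : Matrix (Fin n) (Fin n) ℝ[ε]} {lam : ℝ[ε]}
    (hlam : lam.fst ≠ 0) (hAB : A = lam • B) (x0 : Fin n → ℝ[ε])
    (hpos : ∀ k i, 0 < (((B ^ k) *ᵥ x0) i).fst) (k : ℕ) (i : Fin n) :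
    div' ((A *ᵥ collatzSeq A x0 k) i) (collatzSeq A x0 k i) =
      lam + lam * div' (((B ^ (k + 1)) *ᵥ x0 - (B ^ k) *ᵥ x0) i) (((B ^ k) *ᵥ x0) i) := by
  obtain ⟨c, hc, hk⟩ := exists_collatzSeq_eq_smul hlam hAB x0 hpos k
  have h1 : (A *ᵥ collatzSeq A x0 k) i = c * (lam * ((B ^ (k + 1)) *ᵥ x0) i) := by
    rw [hk, Matrix.mulVec_smul, hAB, Matrix.smul_mulVec, Matrix.mulVec_mulVec, ← pow_succ']
    simp
  rw [h1, hk, Pi.smul_apply, smul_eq_mul, div'_mul_mul hc, Pi.sub_apply, div', div']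
  have h2 := TrivSqZeroExt.mul_inv_cancel (hpos k i).ne'
  linear_combination lam * h2

theorem exists_upperBound_sub_lowerBound_eq [NeZero n] (A : Matrix (Fin n) (Fin n) ℝ[ε])
    (x : Fin n → ℝ[ε]) : ∃ i j, upperBound A x - lowerBound A x =
      div' ((A *ᵥ x) i) (x i) - div' ((A *ᵥ x) j) (x j) := by
  obtain ⟨i, -, hi⟩ := Finset.exists_mem_eq_sup' Finset.univ_nonempty
    (fun i => div' ((A *ᵥ x) i) (x i))
  obtain ⟨j, -, hj⟩ := Finset.exists_mem_eq_inf' Finset.univ_nonempty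
    (fun i => div' ((A *ᵥ x) i) (x i))
  exact ⟨i, j, by rw [upperBound, lowerBound, hi, hj]⟩

end Collatz

/-! ### Decay of the gap. -/

section Rate

variable {B : Matrix (Fin n) (Fin n) ℝ[ε]}

/-- The start dominates a positive multiple of the fixed vector in standard parts, and a nonnegative
matrix preserves this. It keeps the denominators away from `0`. -/
theorem exists_pos_le_fst_pow_mulVec [NeZero n] (hB : ∀ i j, 0 ≤ stdPart B i j) {X : Fin n → ℝ[ε]}
    (hX : ∀ i, 0 < (X i).fst) (hfix : B *ᵥ X = X) {x0 : Fin n → ℝ[ε]}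
    (hx0 : ∀ i, 0 < (x0 i).fst) :
    ∃ m : ℝ, 0 < m ∧ ∀ k i, m ≤ (((B ^ k) *ᵥ x0) i).fst := by
  have hfs : (stdPart B *ᵥ fun j => (X j).fst) = fun j => (X j).fst := by
    ext i; rw [← fst_mulVec, hfix]
  obtain ⟨p, hp⟩ := Finite.exists_min (fun i => (x0 i).fst / (X i).fst)
  obtain ⟨q, hq⟩ := Finite.exists_min (fun i => (X i).fst)
  set c := (x0 p).fst / (X p).fst with hc
  have hc0 : 0 < c := div_pos (hx0 p) (hX p)
  have key : ∀ k i, c * (X i).fst ≤ (((B ^ k) *ᵥ x0) i).fst := by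
    intro k
    induction k with
    | zero =>
      intro i
      rw [← le_div_iff₀ (hX i)]
      simpa using hp i
    | succ k ih =>
      intro i
      rw [pow_succ', ← Matrix.mulVec_mulVec, fst_mulVec]
      exact mulVec_lower_bound hB hfs ih i
  exact ⟨c * (X q).fst, mul_pos hc0 (hX q),
    fun k i => (mul_le_mul_of_nonneg_left (hq i) hc0.le).trans (key k i)⟩

/-- The iterates of a primitive dual number matrix fixing a vector with positive standard part are
bounded, and their increments decay like `√σ ^ k`. -/
theorem complexify_pow_mulVec_isBigO [NeZero n] (hB : IsPrimitive B) {X : Fin n → ℝ[ε]}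
    (hX : ∀ i, 0 < (X i).fst) (hfix : B *ᵥ X = X) (x0 : Fin n → ℝ[ε]) {σ : ℝ} (hσ1 : σ < 1)
    (hσ : ∀ (μ : ℂ) (y : Fin n → ℂ), y ≠ 0 → (stdPart B).map Complex.ofReal *ᵥ y = μ • y →
      μ = 1 ∨ ‖μ‖ ≤ σ) :
    (fun k : ℕ => complexify ((B ^ k) *ᵥ x0)) =O[Filter.atTop] (fun _ => (1 : ℝ)) ∧
    (fun k : ℕ => complexify ((B ^ (k + 1)) *ᵥ x0 - (B ^ k) *ᵥ x0)) =O[Filter.atTop]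
      (fun k => √σ ^ k) := by
  obtain ⟨u, v, huv, hu, hv⟩ := exists_fixed_add_decaying (blockEnd B) (ρ := √σ)
    (fun μ hμ => by
      obtain ⟨y, hy0, hy⟩ := exists_eigenvector_of_blockEnd hμ
      rcases hσ μ y hy0 hy with h | h
      · exact Or.inl h
      · rcases eq_or_ne μ 0 with h0 | h0
        · exact Or.inr (Or.inl h0)
        · have hpos : 0 < σ := (norm_pos_iff.2 h0).trans_le h
          refine Or.inr (Or.inr (h.trans_lt ((Real.lt_sqrt hpos.le).2 ?_)))
          nlinarith)
    (blockEnd_sub_one_eq_zero hB hX hfix) (complexify x0)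
  have hu' : ∀ k : ℕ, (blockEnd B ^ k) u = u := fun k => by
    induction k with
    | zero => simp
    | succ k ih => rw [pow_succ, Module.End.mul_apply, hu, ih]
  have hz : ∀ k : ℕ, complexify ((B ^ k) *ᵥ x0) = u + (blockEnd B ^ k) v := fun k => by
    rw [← blockEnd_pow_complexify, huv, map_add, hu']
  have hle : √σ ≤ 1 := by
    rw [Real.sqrt_le_left zero_le_one]; simpa using hσ1.le
  constructor
  · simp only [hz]
    refine (Asymptotics.isBigO_const_const u one_ne_zero _).add (hv.trans ?_)
    refine Asymptotics.IsBigO.of_bound 1 (Filter.Eventually.of_forall fun k => ?_)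
    rw [Real.norm_of_nonneg (by positivity)]
    simpa using pow_le_one₀ (Real.sqrt_nonneg σ) hle
  · simp only [complexify_sub, hz, add_sub_add_left_eq_sub]
    refine Asymptotics.IsBigO.sub ?_ hv
    refine (hv.comp_tendsto (Filter.tendsto_add_atTop_nat 1)).trans ?_
    refine Asymptotics.IsBigO.of_bound 1 (Filter.Eventually.of_forall fun k => ?_)
    simp only [Function.comp_apply]
    rw [Real.norm_of_nonneg (by positivity), Real.norm_of_nonneg (by positivity), one_mul]
    exact pow_le_pow_of_le_one (Real.sqrt_nonneg σ) hle (Nat.le_succ k)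

theorem abs_fst_div'_le {a b : ℝ[ε]} {m w : ℝ} (hm : 0 < m) (hb : m ≤ b.fst) (ha : |a.fst| ≤ w) :
    |(div' a b).fst| ≤ w / m := by
  rw [fst_div', abs_div, abs_of_pos (hm.trans_le hb)]
  exact div_le_div₀ ((abs_nonneg _).trans ha) ha hm hb

theorem abs_snd_div'_le {a b : ℝ[ε]} {m w M : ℝ} (hm : 0 < m) (hb : m ≤ b.fst)
    (hM : |b.snd| ≤ M) (ha : |a.fst| ≤ w) (ha' : |a.snd| ≤ w) :
    |(div' a b).snd| ≤ w / m + w * M / (m * m) := by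
  have hb0 := hm.trans_le hb
  have hw := (abs_nonneg _).trans ha
  rw [snd_div']
  refine (abs_sub _ _).trans (add_le_add ?_ ?_)
  · rw [abs_div, abs_of_pos hb0]
    exact div_le_div₀ hw ha' hm hb
  · rw [abs_div, abs_mul, abs_of_pos (mul_pos hb0 hb0)]
    exact div_le_div₀ (mul_nonneg hw ((abs_nonneg _).trans hM))
      (mul_le_mul ha hM (abs_nonneg _) hw) (mul_pos hm hm) (mul_le_mul hb hb hm.le hb0.le)

/-- The quotients of the increments decay as fast as the increments. -/
theorem exists_abs_div'_le {x0 : Fin n → ℝ[ε]} {m ρ : ℝ} (hm : 0 < m)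
    (hpos : ∀ k i, m ≤ (((B ^ k) *ᵥ x0) i).fst) (hρ : 0 ≤ ρ)
    (hbdd : (fun k : ℕ => complexify ((B ^ k) *ᵥ x0)) =O[Filter.atTop] (fun _ => (1 : ℝ)))
    (hdec : (fun k : ℕ => complexify ((B ^ (k + 1)) *ᵥ x0 - (B ^ k) *ᵥ x0)) =O[Filter.atTop]
      (fun k => ρ ^ k)) :
    ∃ C : ℝ, 0 < C ∧ ∀ᶠ k : ℕ in Filter.atTop, ∀ i,
      |(div' (((B ^ (k + 1)) *ᵥ x0 - (B ^ k) *ᵥ x0) i) (((B ^ k) *ᵥ x0) i)).fst| ≤ C * ρ ^ k ∧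
      |(div' (((B ^ (k + 1)) *ᵥ x0 - (B ^ k) *ᵥ x0) i) (((B ^ k) *ᵥ x0) i)).snd| ≤ C * ρ ^ k := by
  obtain ⟨M, hM0, hM⟩ := hbdd.exists_pos
  obtain ⟨W, hW0, hW⟩ := hdec.exists_pos
  refine ⟨W / m + W * M / (m * m), by positivity, ?_⟩
  filter_upwards [hM.bound, hW.bound] with k hMk hWk i
  rw [norm_one, mul_one] at hMk
  rw [Real.norm_of_nonneg (by positivity)] at hWk
  have h1 := (norm_fst_le_complexify _ i).trans hWk
  have h2 := (norm_snd_le_complexify _ i).trans hWk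
  have h3 := (norm_snd_le_complexify _ i).trans hMk
  refine ⟨(abs_fst_div'_le hm (hpos k i) h1).trans ?_,
    (abs_snd_div'_le hm (hpos k i) h3 h1 h2).trans (le_of_eq (by ring))⟩
  have : 0 ≤ W * M / (m * m) * ρ ^ k := by positivity
  calc W * ρ ^ k / m = W / m * ρ ^ k := by ring
    _ ≤ (W / m + W * M / (m * m)) * ρ ^ k := by linarith

theorem exists_collatzGap_le [NeZero n] {A : Matrix (Fin n) (Fin n) ℝ[ε]} (hA : IsPrimitive A)
    {lam : ℝ[ε]} (hlam : IsPerronEigenvalue A lam) {x0 : Fin n → ℝ} (hx0 : ∀ i, 0 < x0 i) :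
    √(sigma A lam) < 1 ∧ ∃ Δ : ℝ, 0 < Δ ∧ ∀ᶠ k : ℕ in Filter.atTop,
      |(collatzGap A x0 k).fst| ≤ Δ * √(sigma A lam) ^ k ∧
      |(collatzGap A x0 k).snd| ≤ Δ * √(sigma A lam) ^ k := by
  obtain ⟨hl, X, hX0, hAX⟩ := hlam
  obtain ⟨hl0, hX⟩ := hA.perron_fst_pos hl hX0 hAX
  set B := lam⁻¹ • A with hBdef
  have hB : IsPrimitive B := hA.smul (by simpa using hl0)
  have hAB : A = lam • B := by
    rw [hBdef, smul_smul, TrivSqZeroExt.mul_inv_cancel hl0.ne', one_smul]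
  have hfix : B *ᵥ X = X := by
    rw [hBdef, Matrix.smul_mulVec, hAX.2, smul_smul, TrivSqZeroExt.inv_mul_cancel hl0.ne', one_smul]
  have hfs : (stdPart B *ᵥ fun j => (X j).fst) = fun j => (X j).fst := by
    ext i; rw [← fst_mulVec, hfix]
  obtain ⟨hσ1, hσ⟩ := sigma_bounds hB hX hfs
  change sigma A lam < 1 at hσ1
  change ∀ (μ : ℂ) (y : Fin n → ℂ), y ≠ 0 → (stdPart B).map Complex.ofReal *ᵥ y = μ • y →
      μ = 1 ∨ ‖μ‖ ≤ sigma A lam at hσ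
  refine ⟨by rw [Real.sqrt_lt' one_pos]; simpa using hσ1, ?_⟩
  set z0 : Fin n → ℝ[ε] := fun i => TrivSqZeroExt.inl (x0 i) with hz0
  obtain ⟨m, hm, hpos⟩ := exists_pos_le_fst_pow_mulVec hB.nonneg hX hfix (x0 := z0)
    (fun i => by simpa [hz0] using hx0 i)
  obtain ⟨hbdd, hdec⟩ := complexify_pow_mulVec_isBigO hB hX hfix z0 hσ1 hσ
  obtain ⟨C, hC, hev⟩ := exists_abs_div'_le hm hpos (Real.sqrt_nonneg _) hbdd hdec
  -- The factor `2` counts the two quotients attaining the maximum and minimum; `lam.fst +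
  -- |lam.snd|` bounds multiplication by `lam`.
  refine ⟨2 * ((lam.fst + |lam.snd|) * C), by positivity, ?_⟩
  filter_upwards [hev] with k hk
  obtain ⟨i, j, hij⟩ := exists_upperBound_sub_lowerBound_eq A (collatzSeq A z0 k)
  have hpos' := fun k i => hm.trans_le (hpos k i)
  have hgap : collatzGap A x0 k = _ := hij
  rw [hgap, div'_mulVec_collatzSeq hl0.ne' hAB z0 hpos', div'_mulVec_collatzSeq hl0.ne' hAB z0 hpos',
    add_sub_add_left_eq_sub]
  set t := C * √(sigma A lam) ^ k with ht
  have hmul : ∀ q : ℝ[ε], |q.fst| ≤ t → |q.snd| ≤ t →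
      |(lam * q).fst| ≤ (lam.fst + |lam.snd|) * t ∧ |(lam * q).snd| ≤ (lam.fst + |lam.snd|) * t := by
    intro q h1 h2
    have ht0 := (abs_nonneg _).trans h1
    have e1 : |lam.fst * q.fst| ≤ lam.fst * t := by
      rw [abs_mul, abs_of_pos hl0]; gcongr
    have e2 : |lam.fst * q.snd| ≤ lam.fst * t := by
      rw [abs_mul, abs_of_pos hl0]; gcongr
    have e3 : |lam.snd * q.fst| ≤ |lam.snd| * t := by
      rw [abs_mul]; gcongr
    have e4 : 0 ≤ |lam.snd| * t := by positivity
    constructor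
    · rw [TrivSqZeroExt.fst_mul]; linarith
    · rw [TrivSqZeroExt.snd_mul]
      simp only [smul_eq_mul, MulOpposite.smul_eq_mul_unop, MulOpposite.unop_op]
      exact (abs_add_le _ _).trans (by linarith)
  obtain ⟨a1, a2⟩ := hmul _ (hk i).1 (hk i).2
  obtain ⟨b1, b2⟩ := hmul _ (hk j).1 (hk j).2
  rw [TrivSqZeroExt.fst_sub, TrivSqZeroExt.snd_sub]
  refine ⟨(abs_sub _ _).trans ((add_le_add a1 b1).trans (le_of_eq ?_)),
    (abs_sub _ _).trans ((add_le_add a2 b2).trans (le_of_eq ?_))⟩ <;> rw [ht] <;> ring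

end Rate

theorem tendsto_zero_of_abs_le {f : ℕ → ℝ[ε]} {Δ η : ℝ} (h0 : 0 ≤ η) (h1 : η < 1)
    (h : ∀ᶠ k : ℕ in Filter.atTop, |(f k).fst| ≤ Δ * η ^ k ∧ |(f k).snd| ≤ Δ * η ^ k) :
    Filter.Tendsto f Filter.atTop (𝓝 0) := by
  have hlim : Filter.Tendsto (fun k : ℕ => Δ * η ^ k) Filter.atTop (𝓝 0) := by
    simpa using (tendsto_pow_atTop_nhds_zero_of_lt_one h0 h1).const_mul Δ
  rw [TrivSqZeroExt.nhds_def]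
  exact (squeeze_zero_norm' (h.mono fun k hk => hk.1) hlim).prodMk
    (squeeze_zero_norm' (h.mono fun k hk => hk.2) hlim)

end DualCollatz
end

theorem theorem4p1 {n : ℕ} [NeZero n] (A : Matrix (Fin n) (Fin n) ℝ[ε])
    (hA : DualCollatz.IsPrimitive A)
    (lam : ℝ[ε]) (hlam : DualCollatz.IsPerronEigenvalue A lam)
    (x0 : Fin n → ℝ) (hx0 : ∀ i, 0 < x0 i) :
    Filter.Tendsto (fun k => DualCollatz.collatzGap A x0 k) Filter.atTop (𝓝 0) ∧
    (∃ Δ : ℝ, 0 < Δ ∧ ∃ η ∈ Set.Ioo (0 : ℝ) 1, ∀ᶠ k : ℕ in Filter.atTop,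
      |(DualCollatz.collatzGap A x0 k).fst| ≤ Δ * η ^ k ∧
      |(DualCollatz.collatzGap A x0 k).snd| ≤ Δ * η ^ k) ∧
    (√(DualCollatz.sigma A lam) < 1 ∧
      ∃ Δ : ℝ, 0 < Δ ∧ ∀ᶠ k : ℕ in Filter.atTop,
        |(DualCollatz.collatzGap A x0 k).fst| ≤ Δ * √(DualCollatz.sigma A lam) ^ k ∧
        |(DualCollatz.collatzGap A x0 k).snd| ≤ Δ * √(DualCollatz.sigma A lam) ^ k) := by
  obtain ⟨hσ, Δ, hΔ, hev⟩ := DualCollatz.exists_collatzGap_le hA hlam hx0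
  refine ⟨DualCollatz.tendsto_zero_of_abs_le (Real.sqrt_nonneg _) hσ hev, ?_, hσ, Δ, hΔ, hev⟩
  -- `σ` may be `0`, whereas `η` must be positive.
  refine ⟨Δ, hΔ, max √(DualCollatz.sigma A lam) (1 / 2),
    ⟨lt_max_of_lt_right (by norm_num), max_lt hσ (by norm_num)⟩, hev.mono fun k hk => ?_⟩
  have hpow : Δ * √(DualCollatz.sigma A lam) ^ k ≤
      Δ * max √(DualCollatz.sigma A lam) (1 / 2) ^ k :=
    mul_le_mul_of_nonneg_left (pow_le_pow_left₀ (Real.sqrt_nonneg _) (le_max_left _ _) k) hΔ.le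
  exact ⟨hk.1.trans hpow, hk.2.trans hpow⟩
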